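/- Let $S$ be the K3 surface $w^2=x^6+y^6+z^6$, where $[x:y:z]\in\mathbb{CP}^2$ and $w$ is a point of the total space of the line bundle $\mathcal O(3)$ over $\mathbb{CP}^2$; that is, $S$ is the double cover of the plane branched over the sextic curve $x^6+y^6+z^6=0$. Let $\theta$ be the nowhere-vanishing holomorphic $2$-form on $S$ which in the affine piece $z=1$ is given by $$\theta=\frac{dx\wedge dy}{w},\qquad w^2=x^6+y^6+1,$$ and let $\nu=\theta\wedge\bar\theta$ be the associated volume form on $S$, integrated with the complex orientation. (Thus, where $\theta=g\,ds\wedge dt$ in local holomorphic coordinates $s,t$, the measure $\nu$ is $4|g|^2$ times Lebesgue measure on $\mathbb C^2$.) Then the integral $$L_I=\int_0^1\frac{dp}{(1-p^3)^{2/3}}$$ converges and $$\mathrm{Vol}(S,\nu)=\int_S\nu=27\,L_I^4 .$$ -/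

import Mathlib

open MeasureTheory

noncomputable section

namespace FermatK3

/-- The coordinates `(x, y, z, w)` are `p 0, p 1, p 2, p 3`. -/
abbrev V : Type := Fin 4 → ℂ

/-- The points `(x, y, z, w)` with `(x, y, z) ≠ 0` and `w² = x⁶ + y⁶ + z⁶`. -/
def cone : Set V :=
  {p | (p 0 ≠ 0 ∨ p 1 ≠ 0 ∨ p 2 ≠ 0) ∧ p 3 ^ 2 = p 0 ^ 6 + p 1 ^ 6 + p 2 ^ 6}

/-- The action of `ℂˣ`, with `w` a homogeneous coordinate of degree `3`. The quotient of
`{(x, y, z) ≠ 0}` by it is the total space of `𝒪(3)` over the projective plane. -/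
def scale (t : ℂ) (p : V) : V := ![t * p 0, t * p 1, t * p 2, t ^ 3 * p 3]

/-- Two points of the cone are equivalent when they lie on one `ℂˣ`-orbit. -/
instance coneSetoid : Setoid cone where
  r p q := ∃ t : ℂ, t ≠ 0 ∧ (q : V) = scale t p
  iseqv :=
    { refl := fun p => ⟨1, one_ne_zero, by
        ext i; fin_cases i <;> simp [scale]⟩
      symm := by
        rintro p q ⟨t, ht, h⟩
        refine ⟨t⁻¹, inv_ne_zero ht, ?_⟩
        rw [h]
        ext i; fin_cases i <;> simp [scale, ht]
      trans := by
        rintro p q r ⟨t, ht, h⟩ ⟨s, hs, h'⟩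
        refine ⟨s * t, mul_ne_zero hs ht, ?_⟩
        rw [h', h]
        ext i; fin_cases i <;> simp [scale] <;> ring }

/-- The K3 surface `S`: the locus `w² = x⁶ + y⁶ + z⁶` in the total space of `𝒪(3)` over the
projective plane, that is, the double plane branched over the sextic `x⁶ + y⁶ + z⁶ = 0`. -/
def Surface : Type := Quotient coneSetoid

/-- The quotient topology. -/
instance : TopologicalSpace Surface := inferInstanceAs (TopologicalSpace (Quotient coneSetoid))

/-- The Borel σ-algebra. -/
instance : MeasurableSpace Surface := borel Surface

instance : BorelSpace Surface := ⟨rfl⟩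

/-- The projection of the cone onto the surface. -/
def toSurface (p : cone) : Surface := Quotient.mk coneSetoid p

/-- The vector field generating the `ℂˣ`-action; it spans the kernel of the differential of
`toSurface`. -/
def euler (p : V) : V := ![p 0, p 1, p 2, 3 * p 3]

/-- The partial derivatives of `F = w² - x⁶ - y⁶ - z⁶`. -/
def gradF (p : V) : V := ![-6 * p 0 ^ 5, -6 * p 1 ^ 5, -6 * p 2 ^ 5, 2 * p 3]

/-- The differential of `F = w² - x⁶ - y⁶ - z⁶` at `p`. -/
def dF (p u : V) : ℂ := ∑ i, gradF p i * u i

/-- The complex conjugate of the gradient of `F`, on which `dF` does not vanish along the cone. -/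
def normal (p : V) : V := fun i => (starRingEnd ℂ) (gradF p i)

/-- The holomorphic 2-form `θ`, evaluated on vectors `u, v` tangent to the cone at `p`. Here `θ`
is written as the residue along `F = 0` of `2 (ι_euler dx ∧ dy ∧ dz ∧ dw) / F`, an expression that
is defined at all points of the cone, those with `w = 0` or `z = 0` included. The field `normal`
may be replaced by any `N` with `dF p N ≠ 0` without changing the value. By `theta_affine`,
in the affine piece `z = 1` this is `dx ∧ dy / w`. -/
def theta (p u v : V) : ℂ :=
  2 * Matrix.det (Matrix.of ![euler p, normal p, u, v]) / dF p (normal p)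

theorem dF_normal_ne_zero {p : V} (hp : p ∈ cone) : dF p (normal p) ≠ 0 := by
  have h : dF p (normal p) = ((∑ i, Complex.normSq (gradF p i) : ℝ) : ℂ) := by
    simp [dF, normal, Complex.mul_conj]
  rw [h]
  norm_cast
  intro h0
  rw [Finset.sum_eq_zero_iff_of_nonneg (fun i _ => Complex.normSq_nonneg _)] at h0
  have h1 : ∀ i, gradF p i = 0 := fun i => Complex.normSq_eq_zero.1 (h0 i (Finset.mem_univ i))
  have a := h1 0
  have b := h1 1
  have c := h1 2
  simp [gradF] at a b c
  rcases hp.1 with h | h | h <;> contradiction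

/-- Where `w ≠ 0`, the form `θ` is `(x dy ∧ dz + y dz ∧ dx + z dx ∧ dy) / w`. -/
theorem theta_eq {p u v : V} (hp : p ∈ cone) (hw : p 3 ≠ 0) (hu : dF p u = 0) (hv : dF p v = 0) :
    theta p u v = (p 0 * (u 1 * v 2 - u 2 * v 1) + p 1 * (u 2 * v 0 - u 0 * v 2)
      + p 2 * (u 0 * v 1 - u 1 * v 0)) / p 3 := by
  have hN := dF_normal_ne_zero hp
  have he : dF p (euler p) = 0 := by
    have := hp.2
    simp [dF, Fin.sum_univ_four, gradF, euler]
    linear_combination 6 * this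
  rw [theta, div_eq_div_iff hN hw]
  generalize normal p = N at *
  generalize he' : euler p = e at *
  have e0 : e 0 = p 0 := by simp [← he', euler]
  have e1 : e 1 = p 1 := by simp [← he', euler]
  have e2 : e 2 = p 2 := by simp [← he', euler]
  have g3 : gradF p 3 = 2 * p 3 := by simp [gradF]
  rw [← e0, ← e1, ← e2]
  simp only [dF, Fin.sum_univ_four, g3] at *
  simp [Matrix.det_succ_row_zero, Fin.sum_univ_succ, Fin.succAbove]
  generalize gradF p 0 = a at *
  generalize gradF p 1 = b at *
  generalize gradF p 2 = c at *
  linear_combination -(N 0 * (u 1 * v 2 - u 2 * v 1) - N 1 * (u 0 * v 2 - u 2 * v 0)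
    + N 2 * (u 0 * v 1 - u 1 * v 0)) * he
    - (e 0 * (N 1 * v 2 - N 2 * v 1) - e 1 * (N 0 * v 2 - N 2 * v 0)
    + e 2 * (N 0 * v 1 - N 1 * v 0)) * hu
    + (e 0 * (N 1 * u 2 - N 2 * u 1) - e 1 * (N 0 * u 2 - N 2 * u 0)
    + e 2 * (N 0 * u 1 - N 1 * u 0)) * hv

/-- In the affine piece `z = 1` the form `θ` is `dx ∧ dy / w`. -/
theorem theta_affine {p u v : V} (hp : p ∈ cone) (hz : p 2 = 1) (hw : p 3 ≠ 0)
    (hu : dF p u = 0) (hv : dF p v = 0) (hu2 : u 2 = 0) (hv2 : v 2 = 0) :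
    theta p u v = (u 0 * v 1 - u 1 * v 0) / p 3 := by
  rw [theta_eq hp hw hu hv, hz, hu2, hv2]
  ring

/-- A holomorphic parametrisation of an open part of the surface by an open set `U ⊆ ℂ²`, given
through a holomorphic lift `lift` to the cone: it is injective on `U` and its differential is
injective at each point of `U`. -/
structure Chart where
  U : Set (ℂ × ℂ)
  isOpen : IsOpen U
  lift : ℂ × ℂ → V
  mem_cone : ∀ a ∈ U, lift a ∈ cone
  holomorphic : DifferentiableOn ℂ lift U
  injective : Function.Injective (fun a : U => toSurface ⟨lift a, mem_cone a a.2⟩)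
  immersion : ∀ a ∈ U, LinearIndependent ℂ
    ![euler (lift a), fderiv ℂ lift a (1, 0), fderiv ℂ lift a (0, 1)]

/-- The parametrisation `U → S` itself. -/
def Chart.map (c : Chart) (a : c.U) : Surface := toSurface ⟨c.lift a, c.mem_cone a a.2⟩

/-- The pullback of `θ` to `U`. -/
def Chart.pullback (c : Chart) (a u v : ℂ × ℂ) : ℂ :=
  theta (c.lift a) (fderiv ℂ c.lift a u) (fderiv ℂ c.lift a v)

/-- The value on `v 0, v 1, v 2, v 3` of the wedge product `α ∧ β` of two 2-forms. -/
def wedge {E : Type} (α β : E → E → ℂ) (v : Fin 4 → E) : ℂ :=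
  α (v 0) (v 1) * β (v 2) (v 3) - α (v 0) (v 2) * β (v 1) (v 3) + α (v 0) (v 3) * β (v 1) (v 2)
    + α (v 1) (v 2) * β (v 0) (v 3) - α (v 1) (v 3) * β (v 0) (v 2) + α (v 2) (v 3) * β (v 0) (v 1)

/-- The real basis of `ℂ²`, positive for the complex orientation, whose unit cube has Lebesgue
measure one. -/
def realFrame : Fin 4 → ℂ × ℂ := ![(1, 0), (Complex.I, 0), (0, 1), (0, Complex.I)]

/-- The density, with respect to Lebesgue measure on `U`, of the (real and positive) 4-form
`θ ∧ θ̄` pulled back to `U`. -/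
def Chart.density (c : Chart) (a : ℂ × ℂ) : ℝ :=
  (wedge (c.pullback a) (fun u v => (starRingEnd ℂ) (c.pullback a u v)) realFrame).re

/-- The measure on the surface which is `θ ∧ θ̄` on the image of the chart and `0` outside. -/
def Chart.measure (c : Chart) : Measure Surface :=
  ((Measure.comap Subtype.val (volume : Measure (ℂ × ℂ)) : Measure c.U).withDensity (fun a => ENNReal.ofReal (c.density a))).map c.map

/-- The measure `ν = θ ∧ θ̄` on the surface. The measures given by the charts agree where
the charts overlap, so the measure obtained by gluing them is their supremum in the lattice of
measures. -/
def nu : Measure Surface := ⨆ c : Chart, c.measure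

/-- The length `L_I = ∫₀¹ (1 - p³)^(-2/3) dp`. -/
def LI : ℝ := ∫ p in (0 : ℝ)..1, (1 - p ^ 3) ^ (-(2 / 3) : ℝ)

end FermatK3

end

open Set Real

/-! Off the null loci `z = 0` and `w = 0`, the surface is two copies of the affine plane, one for
each root `w = ±√(x⁶ + y⁶ + 1)`, and `θ ∧ θ̄` has density `4 / |x⁶ + y⁶ + 1|` on each. So the volume
is `8 ∫ |x⁶ + y⁶ + 1|⁻¹` (`FermatK3.nu_univ`).

Because `nu` is a supremum, this takes two bounds. Every chart measure is at most the sum of the two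
sheet measures, by change of variables to `(x / z, y / z)`. Conversely, the two sheet charts have
their images in a set and in its complement, so their masses add.

The substitution `X = x⁶`, `Y = y⁶` (`lintegral_comp_pow`) makes 36 times the integral an iterated
complex beta integral, equal to `π² (Γ(1/6) / Γ(5/6))³` by `lintegral_complex_beta`. Duplication and
reflection reduce this to `Γ(1/3)` and `Γ(2/3)`. Since `L_I = B(1/3, 1/3) / 3 = Γ(1/3)² / (3
Γ(2/3))`, both sides equal `Γ(1/3)⁸ / (3 Γ(2/3)⁴)`. -/

/-! ### Gamma, Gaussian and complex beta integrals -/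

theorem lintegral_rpow_mul_exp_neg_mul_Ioi {k r : ℝ} (hk : 0 < k) (hr : 0 < r) :
    ∫⁻ s in Ioi (0 : ℝ), ENNReal.ofReal (s ^ (k - 1) * exp (-(r * s))) =
      ENNReal.ofReal (Gamma k * r ^ (-k)) := by
  have h := integral_rpow_mul_exp_neg_mul_Ioi hk hr
  have hpos : 0 < (1 / r) ^ k * Gamma k := mul_pos (by positivity) (Gamma_pos_of_pos hk)
  -- Integrability is free: a non-integrable function has Bochner integral `0`, and this one is
  -- positive.
  rw [← ofReal_integral_eq_lintegral_ofReal
    (not_imp_comm.1 integral_undef (by rw [h]; exact hpos.ne')), h]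
  · rw [one_div, inv_rpow hr.le, rpow_neg hr.le, mul_comm]
  · filter_upwards [ae_restrict_mem measurableSet_Ioi] with s hs
    have : (0 : ℝ) < s := hs
    simp only [Pi.zero_apply]
    positivity

theorem lintegral_comp_mul_left_Ioi {a : ℝ} (ha : 0 < a) (f : ℝ → ENNReal) :
    ∫⁻ t in Ioi (0 : ℝ), f t = ∫⁻ v in Ioi (0 : ℝ), ENNReal.ofReal a * f (a * v) := by
  have h := lintegral_image_eq_lintegral_deriv_mul_of_monotoneOn (s := Ioi (0 : ℝ))
    (f := fun v => a * v) (f' := fun _ => a) measurableSet_Ioi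
    (fun x _ => by simpa using ((hasDerivAt_id x).const_mul a).hasDerivWithinAt)
    (fun x _ y _ hxy => mul_le_mul_of_nonneg_left hxy ha.le) f
  rw [← h, Set.image_mul_left_Ioi ha, mul_zero]

/-- The beta integral on the half-line. -/
theorem lintegral_beta_Ioi {a b : ℝ} (ha : 0 < a) (hb : 0 < b) :
    ∫⁻ v in Ioi (0 : ℝ), ENNReal.ofReal (v ^ (b - 1) * (1 + v) ^ (-(a + b))) =
      ENNReal.ofReal (Gamma a * Gamma b / Gamma (a + b)) := by
  have hG : 0 < Gamma (a + b) := Gamma_pos_of_pos (by positivity)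
  have key : ENNReal.ofReal (Gamma (a + b)) *
      ∫⁻ v in Ioi (0 : ℝ), ENNReal.ofReal (v ^ (b - 1) * (1 + v) ^ (-(a + b))) =
        ENNReal.ofReal (Gamma a * Gamma b) := by
    -- Write `Γ(a + b) (1 + v)^(-(a + b))` as a Gamma integral in `r`; by Tonelli the `v`-integral
    -- is then itself a Gamma integral.
    calc _ = ∫⁻ v in Ioi (0 : ℝ), ∫⁻ r in Ioi (0 : ℝ),
          ENNReal.ofReal (v ^ (b - 1) * (r ^ (a + b - 1) * exp (-((1 + v) * r)))) := by
          rw [← lintegral_const_mul _ (by fun_prop)]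
          refine setLIntegral_congr_fun measurableSet_Ioi fun v hv => ?_
          have hv : (0 : ℝ) < v := hv
          have h := lintegral_rpow_mul_exp_neg_mul_Ioi (add_pos ha hb) (show 0 < 1 + v by positivity)
          have hvb : 0 ≤ v ^ (b - 1) := by positivity
          simp only [ENNReal.ofReal_mul hvb]
          rw [lintegral_const_mul _ (by fun_prop), h, ENNReal.ofReal_mul hG.le]
          ring
      _ = ∫⁻ r in Ioi (0 : ℝ), ∫⁻ v in Ioi (0 : ℝ),
          ENNReal.ofReal (v ^ (b - 1) * (r ^ (a + b - 1) * exp (-((1 + v) * r)))) :=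
          lintegral_lintegral_swap (by fun_prop)
      _ = ∫⁻ r in Ioi (0 : ℝ), ENNReal.ofReal (Gamma b) *
            ENNReal.ofReal (r ^ (a - 1) * exp (-(1 * r))) := by
          refine setLIntegral_congr_fun measurableSet_Ioi fun r hr => ?_
          have hr : (0 : ℝ) < r := hr
          have h := lintegral_rpow_mul_exp_neg_mul_Ioi hb hr
          have hc : 0 ≤ r ^ (a + b - 1) * exp (-(1 * r)) := by positivity
          have e : ∀ v : ℝ, v ^ (b - 1) * (r ^ (a + b - 1) * exp (-((1 + v) * r))) =
              (r ^ (a + b - 1) * exp (-(1 * r))) * (v ^ (b - 1) * exp (-(r * v))) := by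
            intro v
            rw [show -((1 + v) * r) = -(1 * r) + -(r * v) by ring, exp_add]
            ring
          simp only [e, ENNReal.ofReal_mul hc]
          rw [lintegral_const_mul _ (by fun_prop), h, ← ENNReal.ofReal_mul hc,
            ← ENNReal.ofReal_mul (Gamma_pos_of_pos hb).le,
            show a - 1 = (a + b - 1) + -b by ring, rpow_add hr]
          congr 1
          ring
      _ = _ := by
          rw [lintegral_const_mul _ (by fun_prop),
            lintegral_rpow_mul_exp_neg_mul_Ioi ha one_pos, one_rpow, mul_one,
            ← ENNReal.ofReal_mul (Gamma_pos_of_pos hb).le, mul_comm]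
  rw [ENNReal.ofReal_div_of_pos hG, ENNReal.eq_div_iff (by simpa using hG) ENNReal.ofReal_ne_top]
  exact key

/-- Complete the square around `-(s / (s + t)) w`, then use translation invariance and the planar
Gaussian integral. -/
theorem lintegral_exp_neg_mul_sq_add {s t : ℝ} (hs : 0 < s) (ht : 0 < t) (w : ℂ) :
    ∫⁻ z : ℂ, ENNReal.ofReal (exp (-(t * ‖z‖ ^ 2)) * exp (-(s * ‖z + w‖ ^ 2))) =
      ENNReal.ofReal (π / (s + t) * exp (-(s * t / (s + t) * ‖w‖ ^ 2))) := by
  have hst : 0 < s + t := by positivity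
  have h := GaussianFourier.integral_rexp_neg_mul_sq_norm (V := ℂ) hst
  simp only [Complex.finrank_real_complex, Nat.cast_ofNat, div_self (two_ne_zero (α := ℝ)),
    rpow_one] at h
  have hl : ∫⁻ z : ℂ, ENNReal.ofReal (exp (-(s + t) * ‖z‖ ^ 2)) = ENNReal.ofReal (π / (s + t)) := by
    rw [← h, ofReal_integral_eq_lintegral_ofReal
      (not_imp_comm.1 integral_undef (by rw [h]; positivity))]
    exact ae_of_all _ fun _ => (exp_pos _).le
  have e : ∀ z : ℂ, exp (-(t * ‖z‖ ^ 2)) * exp (-(s * ‖z + w‖ ^ 2)) =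
      exp (-(s * t / (s + t) * ‖w‖ ^ 2)) * exp (-(s + t) * ‖z + (s / (s + t) : ℝ) • w‖ ^ 2) := by
    intro z
    rw [← exp_add, ← exp_add]
    congr 1
    rw [← Complex.normSq_eq_norm_sq, ← Complex.normSq_eq_norm_sq, ← Complex.normSq_eq_norm_sq,
      ← Complex.normSq_eq_norm_sq]
    simp only [Complex.normSq_apply, Complex.add_re, Complex.add_im, Complex.smul_re,
      Complex.smul_im, smul_eq_mul]
    field_simp
    ring
  simp only [e, ENNReal.ofReal_mul (exp_pos _).le]
  rw [lintegral_const_mul _ (by fun_prop),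
    lintegral_add_right_eq_self (fun z : ℂ => ENNReal.ofReal (exp (-(s + t) * ‖z‖ ^ 2))), hl,
    ← ENNReal.ofReal_mul (exp_pos _).le, mul_comm]

/-- The complex beta integral. -/
theorem lintegral_complex_beta {a b c : ℝ} (ha : 0 < a) (hb : 0 < b) (hc : 0 < c)
    (habc : a + b + c = 1) {w : ℂ} (hw : w ≠ 0) :
    ∫⁻ z : ℂ, ENNReal.ofReal (‖z‖ ^ (2 * a - 2) * ‖z + w‖ ^ (2 * b - 2)) =
      ENNReal.ofReal (π * (Gamma a / Gamma (1 - a)) * (Gamma b / Gamma (1 - b)) *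
        (Gamma c / Gamma (1 - c)) * ‖w‖ ^ (-(2 * c))) := by
  have hA : 0 < Gamma (1 - a) := Gamma_pos_of_pos (by linarith)
  have hB : 0 < Gamma (1 - b) := Gamma_pos_of_pos (by linarith)
  have hC : 0 < Gamma (1 - c) := Gamma_pos_of_pos (by linarith)
  have hGc : 0 < Gamma c := Gamma_pos_of_pos hc
  have hw' : 0 < ‖w‖ := norm_pos_iff.2 hw
  have key : ENNReal.ofReal (Gamma (1 - b) * Gamma (1 - a)) *
      ∫⁻ z : ℂ, ENNReal.ofReal (‖z‖ ^ (2 * a - 2) * ‖z + w‖ ^ (2 * b - 2)) =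
      ENNReal.ofReal (π * Gamma c * ‖w‖ ^ (-(2 * c)) * (Gamma a * Gamma b / Gamma (a + b))) := by
    -- Each power of a norm becomes a Gamma integral of Gaussians, so that the `z`-integral can be
    -- done first. The points `0` and `-w`, where this fails, are null.
    calc _ = ∫⁻ z : ℂ, ∫⁻ s in Ioi (0 : ℝ), ∫⁻ t in Ioi (0 : ℝ),
          ENNReal.ofReal (s ^ (-b) * t ^ (-a) *
            (exp (-(t * ‖z‖ ^ 2)) * exp (-(s * ‖z + w‖ ^ 2)))) := by
          rw [← lintegral_const_mul _ (by fun_prop)]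
          refine lintegral_congr_ae ?_
          filter_upwards [compl_mem_ae_iff.2 (measure_singleton (μ := volume) (0 : ℂ)),
            compl_mem_ae_iff.2 (measure_singleton (μ := volume) (-w))] with z h0 h1
          have hz : 0 < ‖z‖ := norm_pos_iff.2 h0
          have hzw : 0 < ‖z + w‖ := norm_pos_iff.2 fun h => h1 (eq_neg_of_add_eq_zero_left h)
          have hi : ∀ s ∈ Ioi (0 : ℝ), ∫⁻ t in Ioi (0 : ℝ),
              ENNReal.ofReal (s ^ (-b) * t ^ (-a) *
                (exp (-(t * ‖z‖ ^ 2)) * exp (-(s * ‖z + w‖ ^ 2)))) =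
              ENNReal.ofReal (Gamma (1 - a) * (‖z‖ ^ 2) ^ (-(1 - a))) *
                ENNReal.ofReal (s ^ (1 - b - 1) * exp (-(‖z + w‖ ^ 2 * s))) := by
            intro s hs
            have hs : (0 : ℝ) < s := hs
            have hp : 0 ≤ s ^ (1 - b - 1) * exp (-(‖z + w‖ ^ 2 * s)) := by positivity
            have e : ∀ t : ℝ, s ^ (-b) * t ^ (-a) *
                (exp (-(t * ‖z‖ ^ 2)) * exp (-(s * ‖z + w‖ ^ 2))) =
                (s ^ (1 - b - 1) * exp (-(‖z + w‖ ^ 2 * s))) *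
                  (t ^ (1 - a - 1) * exp (-(‖z‖ ^ 2 * t))) := by
              intro t
              rw [show 1 - b - 1 = -b by ring, show 1 - a - 1 = -a by ring, mul_comm t,
                mul_comm s (‖z + w‖ ^ 2)]
              ring
            simp only [e, ENNReal.ofReal_mul hp]
            rw [lintegral_const_mul _ (by fun_prop),
              lintegral_rpow_mul_exp_neg_mul_Ioi (by linarith) (by positivity), mul_comm]
          rw [setLIntegral_congr_fun measurableSet_Ioi hi, lintegral_const_mul _ (by fun_prop),
            lintegral_rpow_mul_exp_neg_mul_Ioi (by linarith) (by positivity),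
            ← ENNReal.ofReal_mul (by positivity), ← ENNReal.ofReal_mul (by positivity),
            ← rpow_natCast, ← rpow_natCast, ← rpow_mul hz.le, ← rpow_mul hzw.le]
          congr 1
          push_cast
          rw [show 2 * a - 2 = 2 * -(1 - a) by ring, show 2 * b - 2 = 2 * -(1 - b) by ring]
          ring
      _ = ∫⁻ s in Ioi (0 : ℝ), ∫⁻ t in Ioi (0 : ℝ), ∫⁻ z : ℂ,
          ENNReal.ofReal (s ^ (-b) * t ^ (-a) *
            (exp (-(t * ‖z‖ ^ 2)) * exp (-(s * ‖z + w‖ ^ 2)))) := by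
          rw [lintegral_lintegral_swap (Measurable.aemeasurable (by
            refine Measurable.lintegral_prod_right' (f := fun q : (ℂ × ℝ) × ℝ =>
              ENNReal.ofReal (q.1.2 ^ (-b) * q.2 ^ (-a) *
                (exp (-(q.2 * ‖q.1.1‖ ^ 2)) * exp (-(q.1.2 * ‖q.1.1 + w‖ ^ 2))))) ?_
            fun_prop))]
          refine lintegral_congr fun s => ?_
          rw [lintegral_lintegral_swap (by fun_prop)]
      _ = ∫⁻ s in Ioi (0 : ℝ), ∫⁻ t in Ioi (0 : ℝ), ENNReal.ofReal (s ^ (-b) * t ^ (-a) *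
            (π / (s + t) * exp (-(s * t / (s + t) * ‖w‖ ^ 2)))) := by
          refine setLIntegral_congr_fun measurableSet_Ioi fun s hs => ?_
          refine setLIntegral_congr_fun measurableSet_Ioi fun t ht => ?_
          have hs : (0 : ℝ) < s := hs
          have ht : (0 : ℝ) < t := ht
          have hp : 0 ≤ s ^ (-b) * t ^ (-a) := by positivity
          simp only [ENNReal.ofReal_mul hp]
          rw [lintegral_const_mul _ (by fun_prop), lintegral_exp_neg_mul_sq_add hs ht]
      -- The substitution `t = s v` makes the exponent linear in `s`. The power of `s` is `-a - b =
      -- c - 1`, so the `s`-integral gives `Γ(c)` and leaves a beta integral in `v`.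
      _ = ∫⁻ s in Ioi (0 : ℝ), ∫⁻ v in Ioi (0 : ℝ), ENNReal.ofReal (π * v ^ (-a) * (1 + v)⁻¹ *
            (s ^ (c - 1) * exp (-((v / (1 + v) * ‖w‖ ^ 2) * s)))) := by
          refine setLIntegral_congr_fun measurableSet_Ioi fun s hs => ?_
          have hs : (0 : ℝ) < s := hs
          rw [lintegral_comp_mul_left_Ioi hs]
          refine setLIntegral_congr_fun measurableSet_Ioi fun v hv => ?_
          have hv : (0 : ℝ) < v := hv
          rw [← ENNReal.ofReal_mul hs.le, mul_rpow hs.le hv.le,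
            show c - 1 = -b + -a by linarith, rpow_add hs]
          congr 1
          rw [show s * (s * v) / (s + s * v) * ‖w‖ ^ 2 = (v / (1 + v) * ‖w‖ ^ 2) * s by
            field_simp]
          field_simp
      _ = ∫⁻ v in Ioi (0 : ℝ), ∫⁻ s in Ioi (0 : ℝ), ENNReal.ofReal (π * v ^ (-a) * (1 + v)⁻¹ *
            (s ^ (c - 1) * exp (-((v / (1 + v) * ‖w‖ ^ 2) * s)))) :=
          lintegral_lintegral_swap (by fun_prop)
      _ = ∫⁻ v in Ioi (0 : ℝ), ENNReal.ofReal (π * Gamma c * ‖w‖ ^ (-(2 * c))) *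
            ENNReal.ofReal (v ^ (b - 1) * (1 + v) ^ (-(a + b))) := by
          refine setLIntegral_congr_fun measurableSet_Ioi fun v hv => ?_
          have hv : (0 : ℝ) < v := hv
          have hv1 : 0 < 1 + v := by positivity
          have hp : 0 ≤ π * v ^ (-a) * (1 + v)⁻¹ := by positivity
          simp only [ENNReal.ofReal_mul hp]
          rw [lintegral_const_mul _ (by fun_prop),
            lintegral_rpow_mul_exp_neg_mul_Ioi hc (by positivity), ← ENNReal.ofReal_mul hp,
            ← ENNReal.ofReal_mul (by positivity), mul_rpow (by positivity) (by positivity),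
            div_rpow hv.le hv1.le, ← rpow_natCast, ← rpow_mul hw'.le,
            show b - 1 = -a + -c by linarith, rpow_add hv,
            show -(a + b) = -1 - -c by linarith, rpow_sub hv1, rpow_neg_one]
          congr 1
          rw [show ((2 : ℕ) : ℝ) * -c = -(2 * c) by push_cast; ring]
          ring
      _ = _ := by
          rw [lintegral_const_mul _ (by fun_prop), lintegral_beta_Ioi ha hb,
            ← ENNReal.ofReal_mul (by positivity)]
  have hne : ENNReal.ofReal (Gamma (1 - b) * Gamma (1 - a)) ≠ 0 := by
    simpa using mul_pos hB hA
  rw [← ENNReal.mul_right_inj hne ENNReal.ofReal_ne_top, key,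
    ← ENNReal.ofReal_mul (by positivity), show a + b = 1 - c by linarith]
  congr 1
  field_simp

/-! ### Power maps of the complex plane -/

/-- The integrand descends to the circle, where multiplication by a nonzero integer preserves Haar
measure. -/
theorem lintegral_Ioo_comp_nsmul_angle {n : ℕ} (hn : n ≠ 0) (f : ℂ → ENNReal)
    (hf : Measurable f) (r : ℝ) :
    ∫⁻ θ in Ioo (-π) π, f (r * Complex.exp ((n * θ : ℝ) * Complex.I)) =
      ∫⁻ θ in Ioo (-π) π, f (r * Complex.exp (θ * Complex.I)) := by
  have : Fact (0 < 2 * π) := ⟨by positivity⟩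
  let F : AddCircle (2 * π) → ENNReal := fun θ => f (r * (AddCircle.toCircle θ : ℂ))
  have hF : Measurable F :=
    hf.comp (measurable_const.mul ((continuous_subtype_val.comp
      AddCircle.continuous_toCircle).measurable))
  have hcoe : ∀ x : ℝ, F (x : AddCircle (2 * π)) = f (r * Complex.exp (x * Complex.I)) := by
    intro x
    simp only [F, AddCircle.toCircle_apply_mk, Circle.coe_exp]
    rw [div_self (by positivity), one_mul]
  have hn' : (n : ℤ) ≠ 0 := by exact_mod_cast hn
  have hmp := Measure.measurePreserving_zsmul (volume : Measure (AddCircle (2 * π))) hn'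
  have h1 := AddCircle.lintegral_preimage (2 * π) (-π) F
  have h2 := AddCircle.lintegral_preimage (2 * π) (-π) (fun x => F ((n : ℤ) • x))
  rw [hmp.lintegral_comp hF, ← h1] at h2
  rw [show -π + 2 * π = π by ring] at h2
  rw [setLIntegral_congr Ioo_ae_eq_Ioc, setLIntegral_congr Ioo_ae_eq_Ioc]
  simp only [← hcoe]
  rw [← h2]
  refine lintegral_congr fun x => ?_
  congr 1
  simp

theorem lintegral_complex_polar (f : ℂ → ENNReal) (hf : Measurable f) :
    ∫⁻ z, f z = ∫⁻ r in Ioi (0 : ℝ), ENNReal.ofReal r *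
      ∫⁻ θ in Ioo (-π) π, f (r * Complex.exp (θ * Complex.I)) := by
  rw [← Complex.lintegral_comp_polarCoord_symm, polarCoord_target,
    Measure.volume_eq_prod, ← Measure.prod_restrict, lintegral_prod]
  · refine lintegral_congr fun r => ?_
    simp only [smul_eq_mul]
    rw [lintegral_const_mul]
    · refine congrArg _ (lintegral_congr fun θ => ?_)
      rw [Complex.polarCoord_symm_apply, Complex.exp_mul_I]
      push_cast
      rfl
    · simp only [Complex.polarCoord_symm_apply]
      fun_prop
  · simp only [Complex.polarCoord_symm_apply, smul_eq_mul]
    fun_prop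

/-- Change of variables along the `n`-th power map of the complex plane. -/
theorem lintegral_comp_pow {n : ℕ} (hn : n ≠ 0) (f : ℂ → ENNReal) (hf : Measurable f) :
    n * ∫⁻ z : ℂ, f (z ^ n) = ∫⁻ z : ℂ, f z * ENNReal.ofReal (‖z‖ ^ (2 / n - 2 : ℝ)) := by
  have hn0 : (n : ℝ) ≠ 0 := by exact_mod_cast hn
  rw [lintegral_complex_polar _ (by fun_prop), lintegral_complex_polar _ (by fun_prop)]
  have h := lintegral_image_eq_lintegral_deriv_mul_of_monotoneOn (s := Ioi (0 : ℝ))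
    (f := fun v => v ^ n) (f' := fun v => n * v ^ (n - 1)) measurableSet_Ioi
    (fun x _ => (hasDerivAt_pow n x).hasDerivWithinAt)
    (fun x hx y _ hxy => pow_le_pow_left₀ (le_of_lt hx) hxy n)
    (fun r => ENNReal.ofReal r * ∫⁻ θ in Ioo (-π) π, f (r * Complex.exp (θ * Complex.I)) *
      ENNReal.ofReal (‖(r * Complex.exp (θ * Complex.I) : ℂ)‖ ^ (2 / n - 2 : ℝ)))
  have him : (fun v : ℝ => v ^ n) '' Ioi 0 = Ioi 0 := by
    ext x
    constructor
    · rintro ⟨v, hv, rfl⟩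
      exact pow_pos (mem_Ioi.1 hv) n
    · intro hx
      have hx : (0 : ℝ) < x := hx
      exact ⟨x ^ (n : ℝ)⁻¹, rpow_pos_of_pos hx _, rpow_inv_natCast_pow hx.le hn⟩
  rw [him] at h
  rw [h, ← lintegral_const_mul' _ _ (by simp)]
  refine setLIntegral_congr_fun measurableSet_Ioi fun r hr => ?_
  have hr : (0 : ℝ) < r := hr
  have e1 : ∀ θ : ℝ, f ((r * Complex.exp (θ * Complex.I)) ^ n) =
      f ((r ^ n : ℝ) * Complex.exp ((n * θ : ℝ) * Complex.I)) := by
    intro θ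
    rw [mul_pow, ← Complex.exp_nat_mul]
    push_cast
    rw [mul_assoc]
  have e2 : ∀ θ : ℝ, ‖((r ^ n : ℝ) * Complex.exp (θ * Complex.I) : ℂ)‖ = r ^ n := by
    intro θ
    rw [norm_mul, Complex.norm_exp_ofReal_mul_I, mul_one, Complex.norm_real, norm_of_nonneg]
    positivity
  simp only [e1, e2]
  rw [lintegral_Ioo_comp_nsmul_angle hn f hf, lintegral_mul_const' _ _ ENNReal.ofReal_ne_top,
    ← ENNReal.ofReal_natCast]
  generalize ∫⁻ θ in Ioo (-π) π, f ((r ^ n : ℝ) * Complex.exp (θ * Complex.I)) = J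
  -- The radial Jacobian: with `ρ = r ^ n`, `n r dr = ρ ^ (2 / n - 1) dρ`, and one factor `ρ`
  -- belongs to the polar measure.
  have e3 : n * r = n * r ^ (n - 1) * (r ^ n * (r ^ n) ^ (2 / n - 2 : ℝ)) := by
    obtain ⟨m, rfl⟩ := Nat.exists_eq_succ_of_ne_zero hn
    rw [mul_assoc]
    congr 1
    rw [← rpow_natCast r (m + 1), ← rpow_mul hr.le, Nat.succ_sub_one, ← rpow_natCast r m,
      ← rpow_add hr, ← rpow_add hr]
    conv_lhs => rw [← rpow_one r]
    congr 1
    field_simp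
    push_cast
    ring
  rw [← mul_assoc, ← ENNReal.ofReal_mul (by positivity), e3, ENNReal.ofReal_mul (by positivity),
    ENNReal.ofReal_mul (by positivity), ENNReal.ofReal_mul (p := r ^ n) (by positivity)]
  ring

/-! ### The sextic integral and `L_I` in Gamma values -/

theorem lintegral_inv_norm_fermat_sextic :
    36 * ∫⁻ p : ℂ × ℂ, ENNReal.ofReal (‖p.1 ^ 6 + p.2 ^ 6 + 1‖⁻¹) =
      ENNReal.ofReal (π ^ 2 * (Gamma (1 / 6) / Gamma (5 / 6)) ^ 3) := by
  rw [Measure.volume_eq_prod, lintegral_prod _ (by fun_prop)]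
  have hg : Measurable fun c : ℂ => ∫⁻ y : ℂ, ENNReal.ofReal (‖c + y ^ 6 + 1‖⁻¹) := by
    refine Measurable.lintegral_prod_right' (f := fun q : ℂ × ℂ =>
      ENNReal.ofReal (‖q.1 + q.2 ^ 6 + 1‖⁻¹)) ?_
    fun_prop
  have h1 := lintegral_comp_pow (n := 6) (by norm_num) _ hg
  have h2 : ∀ c : ℂ, c ≠ -1 → 6 * ∫⁻ y : ℂ, ENNReal.ofReal (‖c + y ^ 6 + 1‖⁻¹) =
      ENNReal.ofReal (π * (Gamma (1 / 6) / Gamma (5 / 6))) *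
        ENNReal.ofReal (‖c + 1‖ ^ (-(2 / 3) : ℝ) * (Gamma (1 / 3) / Gamma (2 / 3))) := by
    intro c hc
    have hc' : c + 1 ≠ 0 := fun h => hc (eq_neg_of_add_eq_zero_left h)
    have h3 := lintegral_comp_pow (n := 6) (by norm_num)
      (fun y : ℂ => ENNReal.ofReal (‖c + y + 1‖⁻¹)) (by fun_prop)
    rw [show ((6 : ℕ) : ENNReal) = 6 by norm_num] at h3
    rw [h3]
    -- `2a - 2 = -5/3` is the weight from the sixth-power substitution and `2b - 2 = -1` the
    -- exponent of the integrand. The factor for `b = 1/2` is `1`.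
    have h4 := lintegral_complex_beta (a := 1 / 6) (b := 1 / 2) (c := 1 / 3) (by norm_num)
      (by norm_num) (by norm_num) (by norm_num) hc'
    have hh : 0 < Gamma (1 / 2) := Gamma_pos_of_pos (by norm_num)
    have h6 : 0 < Gamma (1 / 6) := Gamma_pos_of_pos (by norm_num)
    have h5 : 0 < Gamma (5 / 6) := Gamma_pos_of_pos (by norm_num)
    rw [← ENNReal.ofReal_mul (by positivity)]
    rw [show (1 : ℝ) - 1 / 2 = 1 / 2 by norm_num, div_self hh.ne',
      show (1 : ℝ) - 1 / 6 = 5 / 6 by norm_num, show (1 : ℝ) - 1 / 3 = 2 / 3 by norm_num] at h4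
    calc _ = _ := by
          refine lintegral_congr fun y => ?_
          rw [← ENNReal.ofReal_mul (by positivity)]
          congr 1
          rw [mul_comm, ← rpow_neg_one, show c + y + 1 = y + (c + 1) by ring]
          norm_num
      _ = _ := h4
      _ = _ := by
          congr 1
          rw [show -(2 * (1 / 3 : ℝ)) = -(2 / 3) by norm_num]
          ring
  -- Here `2b - 2 = -2/3` is the exponent left by the inner integral. The factors `Γ(1/3) / Γ(2/3)`
  -- and `Γ(2/3) / Γ(1/3)` of the two integrals cancel.
  have h3 := lintegral_complex_beta (a := 1 / 6) (b := 2 / 3) (c := 1 / 6) (by norm_num)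
    (by norm_num) (by norm_num) (by norm_num) (one_ne_zero (α := ℂ))
  have p1 : 0 < Gamma (1 / 6) := Gamma_pos_of_pos (by norm_num)
  have p5 : 0 < Gamma (5 / 6) := Gamma_pos_of_pos (by norm_num)
  have p2 : 0 < Gamma (1 / 3) := Gamma_pos_of_pos (by norm_num)
  have p4 : 0 < Gamma (2 / 3) := Gamma_pos_of_pos (by norm_num)
  rw [show ((6 : ℕ) : ENNReal) = 6 by norm_num] at h1
  rw [show (36 : ENNReal) = 6 * 6 by norm_num, mul_assoc, h1,
    ← lintegral_const_mul' _ _ (by simp)]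
  calc _ = ∫⁻ z : ℂ, ENNReal.ofReal (π * (Gamma (1 / 6) / Gamma (5 / 6)) *
          (Gamma (1 / 3) / Gamma (2 / 3))) *
        ENNReal.ofReal (‖z‖ ^ (2 * (1 / 6) - 2 : ℝ) * ‖z + 1‖ ^ (2 * (2 / 3) - 2 : ℝ)) := by
        refine lintegral_congr_ae ?_
        filter_upwards [compl_mem_ae_iff.2 (measure_singleton (μ := volume) (-1 : ℂ))] with z hz
        rw [← mul_assoc, h2 z hz, ← ENNReal.ofReal_mul (by positivity),
          ← ENNReal.ofReal_mul (by positivity), ← ENNReal.ofReal_mul (by positivity)]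
        congr 1
        norm_num
        ring
    _ = _ := by
        rw [lintegral_const_mul _ (by fun_prop), h3, ← ENNReal.ofReal_mul (by positivity)]
        congr 1
        rw [norm_one, one_rpow, show (1 : ℝ) - 1 / 6 = 5 / 6 by norm_num,
          show (1 : ℝ) - 2 / 3 = 1 / 3 by norm_num]
        field_simp

theorem Gamma_one_third_mul_Gamma_two_thirds : Gamma (1 / 3) * Gamma (2 / 3) = 2 * π / √3 := by
  have h := Gamma_mul_Gamma_one_sub (1 / 3)
  rw [show (1 : ℝ) - 1 / 3 = 2 / 3 by norm_num, show π * (1 / 3) = π / 3 by ring,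
    sin_pi_div_three] at h
  rw [h]
  field_simp

/-- Duplication at `1/6` gives `Γ(1/6)` through `Γ(1/3)`, `Γ(2/3)`, `√π` and `2^(2/3)`; reflection
gives `Γ(5/6) = 2π / Γ(1/6)`. Cubing makes the power of `2` rational. -/
theorem Gamma_one_sixth_div_Gamma_five_sixths_pow :
    (Gamma (1 / 6) / Gamma (5 / 6)) ^ 3 = 2 * (Gamma (1 / 3) / Gamma (2 / 3)) ^ 6 := by
  have h1 := Gamma_mul_Gamma_add_half (1 / 6)
  have h2 := Gamma_mul_Gamma_one_sub (1 / 6)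
  have p1 : 0 < Gamma (1 / 6) := Gamma_pos_of_pos (by norm_num)
  have p5 : 0 < Gamma (5 / 6) := Gamma_pos_of_pos (by norm_num)
  have p2 : 0 < Gamma (1 / 3) := Gamma_pos_of_pos (by norm_num)
  have p4 : 0 < Gamma (2 / 3) := Gamma_pos_of_pos (by norm_num)
  rw [show (1 : ℝ) / 6 + 1 / 2 = 2 / 3 by norm_num, show 2 * ((1 : ℝ) / 6) = 1 / 3 by norm_num,
    show (1 : ℝ) - 1 / 3 = 2 / 3 by norm_num] at h1
  rw [show (1 : ℝ) - 1 / 6 = 5 / 6 by norm_num, show π * (1 / 6) = π / 6 by ring,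
    sin_pi_div_six] at h2
  have hs : √π ^ 2 = π := sq_sqrt pi_pos.le
  have ht : ((2 : ℝ) ^ (2 / 3 : ℝ)) ^ 3 = 4 := by
    rw [← rpow_natCast, ← rpow_mul (by norm_num)]
    norm_num
  have e1 : Gamma (1 / 6) = Gamma (1 / 3) * 2 ^ (2 / 3 : ℝ) * √π / Gamma (2 / 3) := by
    rw [eq_div_iff p4.ne', h1]
  have e2 : Gamma (1 / 6) / Gamma (5 / 6) = Gamma (1 / 6) ^ 2 / (2 * π) := by
    rw [div_eq_div_iff p5.ne' (by positivity)]
    linear_combination -Gamma (1 / 6) * h2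
  rw [e2, e1]
  have : ((Gamma (1 / 3) * 2 ^ (2 / 3 : ℝ) * √π / Gamma (2 / 3)) ^ 2 / (2 * π)) ^ 3 =
      Gamma (1 / 3) ^ 6 / Gamma (2 / 3) ^ 6 * (((2 : ℝ) ^ (2 / 3 : ℝ)) ^ 3) ^ 2 *
        (√π ^ 2) ^ 3 / (8 * π ^ 3) := by
    ring
  rw [this, ht, hs]
  field_simp
  norm_num

/-- As `p³ ≤ p` on `[0, 1]`, the integrand is dominated by `(1 - p)^(-2/3)`. -/
theorem intervalIntegrable_one_sub_cube_rpow :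
    IntervalIntegrable (fun p : ℝ => (1 - p ^ 3) ^ (-(2 / 3) : ℝ)) volume 0 1 := by
  have h := (intervalIntegral.intervalIntegrable_rpow' (a := 0) (b := 1) (r := -(2 / 3))
    (by norm_num)).comp_sub_left 1
  rw [sub_zero, sub_self] at h
  refine (h.symm).mono_fun (Measurable.aestronglyMeasurable (by fun_prop)) ?_
  rw [uIoc_of_le zero_le_one]
  filter_upwards [ae_restrict_mem measurableSet_Ioc] with p hp
  have h0 : 0 ≤ 1 - p := by linarith [hp.2]
  have h1 : 1 - p ≤ 1 - p ^ 3 := by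
    have : p ^ 3 ≤ p := pow_le_of_le_one hp.1.le hp.2 (by norm_num)
    linarith
  rw [norm_of_nonneg (rpow_nonneg (h0.trans h1) _), norm_of_nonneg (rpow_nonneg h0 _)]
  rcases h0.eq_or_lt with h0 | h0
  · have : p = 1 := by linarith
    subst this
    norm_num
  · exact rpow_le_rpow_of_nonpos h0 h1 (by norm_num)

/-- The substitution `x = p³` turns the Beta(1/3, 1/3) density, of total mass one, into a multiple
of this integrand. -/
theorem integral_one_sub_cube_rpow :
    ∫ p in (0 : ℝ)..1, (1 - p ^ 3) ^ (-(2 / 3) : ℝ) =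
      Gamma (1 / 3) ^ 2 / (3 * Gamma (2 / 3)) := by
  have hB : 0 < ProbabilityTheory.beta (1 / 3) (1 / 3) :=
    ProbabilityTheory.beta_pos (by norm_num) (by norm_num)
  have p2 : 0 < Gamma (1 / 3) := Gamma_pos_of_pos (by norm_num)
  have p4 : 0 < Gamma (2 / 3) := Gamma_pos_of_pos (by norm_num)
  have hnn : ∀ x, 0 ≤ ProbabilityTheory.betaPDFReal (1 / 3) (1 / 3) x := by
    intro x
    by_cases hx : 0 < x ∧ x < 1
    · exact (ProbabilityTheory.betaPDFReal_pos hx.1 hx.2 (by norm_num) (by norm_num)).le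
    · rw [ProbabilityTheory.betaPDFReal, if_neg hx]
  have h1 : ∫ x in Ioi (0 : ℝ), ProbabilityTheory.betaPDFReal (1 / 3) (1 / 3) x = 1 := by
    rw [setIntegral_eq_integral_of_forall_compl_eq_zero, integral_eq_lintegral_of_nonneg_ae
      (ae_of_all _ hnn) (by fun_prop)]
    · have := ProbabilityTheory.lintegral_betaPDF_eq_one (α := 1 / 3) (β := 1 / 3)
        (by norm_num) (by norm_num)
      simp only [ProbabilityTheory.betaPDF] at this
      rw [this, ENNReal.toReal_one]
    · intro x hx
      rw [ProbabilityTheory.betaPDFReal, if_neg fun h => hx h.1]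
  have h := integral_comp_rpow_Ioi_of_pos (p := 3) (by norm_num)
    (g := ProbabilityTheory.betaPDFReal (1 / 3) (1 / 3))
  rw [h1] at h
  have h2 : ∫ x in Ioi (0 : ℝ), (3 * x ^ (3 - 1 : ℝ)) •
      ProbabilityTheory.betaPDFReal (1 / 3) (1 / 3) (x ^ (3 : ℝ)) =
      ∫ x in Ioi (0 : ℝ), (Ioo (0 : ℝ) 1).indicator (fun x =>
        3 / ProbabilityTheory.beta (1 / 3) (1 / 3) * (1 - x ^ 3) ^ (-(2 / 3) : ℝ)) x := by
    refine setIntegral_congr_fun measurableSet_Ioi fun x hx => ?_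
    have hx : (0 : ℝ) < x := hx
    have h3 : x ^ (3 : ℝ) = x ^ 3 := by exact_mod_cast rpow_natCast x 3
    by_cases h1 : x < 1
    · have hx3 : x ^ 3 < 1 := pow_lt_one₀ hx.le h1 (by norm_num)
      rw [indicator_of_mem (show x ∈ Ioo (0 : ℝ) 1 from ⟨hx, h1⟩)]
      rw [h3, ProbabilityTheory.betaPDFReal, if_pos ⟨by positivity, hx3⟩, ← h3,
        ← rpow_mul hx.le, h3, smul_eq_mul,
        show (1 : ℝ) / 3 - 1 = -(2 / 3) by norm_num, show (3 : ℝ) * -(2 / 3) = -2 by norm_num,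
        show (3 : ℝ) - 1 = 2 by norm_num, rpow_neg hx.le]
      have : x ^ (2 : ℝ) ≠ 0 := (rpow_pos_of_pos hx _).ne'
      field_simp
    · have hx3 : 1 ≤ x ^ 3 := one_le_pow₀ (not_lt.1 h1)
      rw [indicator_of_notMem fun h => h1 h.2]
      rw [h3, ProbabilityTheory.betaPDFReal, if_neg fun h => absurd h.2 (not_lt.2 hx3), smul_zero]
  rw [h2, setIntegral_indicator measurableSet_Ioo, inter_eq_right.2 Ioo_subset_Ioi_self,
    integral_const_mul, ← integral_Ioc_eq_integral_Ioo,
    ← intervalIntegral.integral_of_le zero_le_one] at h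
  have h4 : ProbabilityTheory.beta (1 / 3) (1 / 3) = Gamma (1 / 3) ^ 2 / Gamma (2 / 3) := by
    rw [ProbabilityTheory.beta, show (1 : ℝ) / 3 + 1 / 3 = 2 / 3 by norm_num, sq]
  rw [h4] at h
  field_simp at h ⊢
  linarith

theorem eight_mul_lintegral_inv_norm_fermat_sextic :
    8 * ∫⁻ p : ℂ × ℂ, ENNReal.ofReal (‖p.1 ^ 6 + p.2 ^ 6 + 1‖⁻¹) =
      ENNReal.ofReal (27 * FermatK3.LI ^ 4) := by
  have h := lintegral_inv_norm_fermat_sextic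
  have p2 : 0 < Gamma (1 / 3) := Gamma_pos_of_pos (by norm_num)
  have p4 : 0 < Gamma (2 / 3) := Gamma_pos_of_pos (by norm_num)
  rw [Gamma_one_sixth_div_Gamma_five_sixths_pow] at h
  rw [← ENNReal.mul_right_inj (a := 36) (by norm_num) (by norm_num), mul_left_comm, h,
    FermatK3.LI, integral_one_sub_cube_rpow, show (8 : ENNReal) = ENNReal.ofReal 8 by simp,
    show (36 : ENNReal) = ENNReal.ofReal 36 by simp, ← ENNReal.ofReal_mul (by norm_num),
    ← ENNReal.ofReal_mul (by norm_num)]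
  congr 1
  -- Reflection at `1/3` eliminates `π`, leaving a rational identity in the two Gamma values.
  have hp : π ^ 2 = 3 / 4 * (Gamma (1 / 3) * Gamma (2 / 3)) ^ 2 := by
    rw [Gamma_one_third_mul_Gamma_two_thirds, div_pow, sq_sqrt (by norm_num)]
    ring
  rw [hp]
  field_simp
  norm_num

/-! ### Null sets and Jacobians in `ℂ²` -/

theorem volume_im_eq_zero : volume {z : ℂ | z.im = 0} = 0 := by
  have h := Measure.addHaar_submodule (volume : Measure ℂ) (LinearMap.ker Complex.imLm) (by
    intro h
    have : Complex.I ∈ LinearMap.ker Complex.imLm := h ▸ Submodule.mem_top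
    simp at this)
  convert h using 2
  ext z
  simp

/-- For fixed `x`, the bad values of `Y = y⁶` lie on a translate of the real line;
`lintegral_comp_pow` pulls this null set back to a null set of `y`. -/
theorem volume_fermat_sextic_notMem_slitPlane :
    volume {p : ℂ × ℂ | p.1 ^ 6 + p.2 ^ 6 + 1 ∉ Complex.slitPlane} = 0 := by
  have hm : MeasurableSet Complex.slitPlane := Complex.isOpen_slitPlane.measurableSet
  rw [Measure.volume_eq_prod, Measure.measure_prod_null]
  · refine Filter.Eventually.of_forall fun x => ?_
    let s : Set ℂ := {Y | x ^ 6 + Y + 1 ∉ Complex.slitPlane}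
    have hs : MeasurableSet s := by
      have : Measurable fun Y : ℂ => x ^ 6 + Y + 1 := by fun_prop
      exact (this hm).compl
    have hs0 : volume s = 0 := by
      refine measure_mono_null (t := (fun Y => (x ^ 6 + 1) + Y) ⁻¹' {z : ℂ | z.im = 0}) ?_ ?_
      · intro Y hY
        simp only [s, mem_ofPred_eq, Complex.mem_slitPlane_iff, not_or, not_not] at hY
        rw [mem_preimage, mem_ofPred_eq, ← hY.2]
        congr 1
        ring
      · rw [measure_preimage_add]
        exact volume_im_eq_zero
    have h := lintegral_comp_pow (n := 6) (by norm_num) (s.indicator 1)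
      (measurable_one.indicator hs)
    have h0 : ∫⁻ Y : ℂ, s.indicator 1 Y * ENNReal.ofReal (‖Y‖ ^ (2 / (6 : ℕ) - 2 : ℝ)) = 0 := by
      rw [lintegral_eq_zero_iff (by measurability)]
      filter_upwards [compl_mem_ae_iff.2 hs0] with Y hY
      rw [indicator_of_notMem hY, zero_mul, Pi.zero_apply]
    rw [h0, mul_eq_zero] at h
    have h := h.resolve_left (by norm_num)
    have e : ∀ y : ℂ, s.indicator (1 : ℂ → ENNReal) (y ^ 6) =
        ((fun y : ℂ => y ^ 6) ⁻¹' s).indicator 1 y := fun _ => rfl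
    simp only [e] at h
    rwa [lintegral_indicator_one ((by fun_prop : Measurable fun y : ℂ => y ^ 6) hs)] at h
  · have : Measurable fun p : ℂ × ℂ => p.1 ^ 6 + p.2 ^ 6 + 1 := by fun_prop
    exact (this hm).compl

/-- Simple zeros are isolated, so `s` is locally a single point. -/
theorem volume_zeros_eq_zero_of_deriv_ne_zero {g : ℂ → ℂ} {s : Set ℂ}
    (h : ∀ x ∈ s, g x = 0 ∧ ∃ g', HasDerivAt g g' x ∧ g' ≠ 0) : volume s = 0 := by
  refine measure_null_of_locally_null s fun x hx => ⟨{x}, ?_, measure_singleton x⟩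
  obtain ⟨-, g', hg, hg'⟩ := h x hx
  have h1 := hg.eventually_ne (c := 0) hg'
  rw [eventually_nhdsWithin_iff] at h1
  rw [mem_nhdsWithin_iff_eventually]
  filter_upwards [h1] with y hy hys
  by_contra hne
  exact hy hne (h y hys).1

/-- A holomorphic function on an open subset of `ℂ²` whose differential does not vanish at its
zeros has a null set of zeros. -/
theorem volume_zeros_eq_zero_of_fderiv_ne_zero {f : ℂ × ℂ → ℂ} {U : Set (ℂ × ℂ)} (hU : IsOpen U)
    (hf : DifferentiableOn ℂ f U)
    (h : ∀ a ∈ U, f a = 0 → fderiv ℂ f a (1, 0) ≠ 0 ∨ fderiv ℂ f a (0, 1) ≠ 0) :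
    volume {a ∈ U | f a = 0} = 0 := by
  have hZ : MeasurableSet {a ∈ U | f a = 0} := by
    have : Measurable (U.domRestrict f) :=
      (continuousOn_iff_continuous_domRestrict.1 hf.continuousOn).measurable
    have := MeasurableSet.subtype_image hU.measurableSet (this (measurableSet_singleton (0 : ℂ)))
    convert this using 1
    ext a
    simp [Set.domRestrict, and_comm]
  have hd : ∀ v : ℂ × ℂ, MeasurableSet {a | fderiv ℂ f a v ≠ 0} := fun v =>
    (measurable_fderiv_apply_const ℂ f v) (measurableSet_singleton 0).compl
  have hfd : ∀ a ∈ U, HasFDerivAt f (fderiv ℂ f a) a := fun a ha =>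
    (hf.differentiableAt (hU.mem_nhds ha)).hasFDerivAt
  -- Split by which partial derivative is nonzero and slice in that variable: each slice consists of
  -- simple zeros.
  refine measure_mono_null (t := ({a ∈ U | f a = 0} ∩ {a | fderiv ℂ f a (1, 0) ≠ 0}) ∪
    ({a ∈ U | f a = 0} ∩ {a | fderiv ℂ f a (0, 1) ≠ 0})) ?_ (measure_union_null ?_ ?_)
  · intro a ha
    exact (h a ha.1 ha.2).imp (fun h => ⟨ha, h⟩) (fun h => ⟨ha, h⟩)
  · rw [Measure.volume_eq_prod, Measure.prod_apply_symm (hZ.inter (hd _))]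
    refine (lintegral_congr fun t => ?_).trans lintegral_zero
    refine volume_zeros_eq_zero_of_deriv_ne_zero (g := fun s => f (s, t)) fun s hs =>
      ⟨hs.1.2, _, ?_, hs.2⟩
    exact (hfd _ hs.1.1).comp_hasDerivAt s ((hasDerivAt_id s).prodMk (hasDerivAt_const s t))
  · rw [Measure.volume_eq_prod, Measure.prod_apply (hZ.inter (hd _))]
    refine (lintegral_congr fun s => ?_).trans lintegral_zero
    refine volume_zeros_eq_zero_of_deriv_ne_zero (g := fun t => f (s, t)) fun t hs =>
      ⟨hs.1.2, _, ?_, hs.2⟩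
    exact (hfd _ hs.1.1).comp_hasDerivAt t ((hasDerivAt_const t s).prodMk (hasDerivAt_id t))

/-- The real determinant of a complex linear map is the squared modulus of its complex determinant.
-/
theorem det_restrictScalars_complex_prod (f : ℂ × ℂ →L[ℂ] ℂ × ℂ) :
    (f.restrictScalars ℝ).det =
      ‖(f (1, 0)).1 * (f (0, 1)).2 - (f (1, 0)).2 * (f (0, 1)).1‖ ^ 2 := by
  have h : ((f : ℂ × ℂ →ₗ[ℂ] ℂ × ℂ).restrictScalars ℝ).det = _ := LinearMap.det_restrictScalars
  have h2 : (f.restrictScalars ℝ).det = ((f : ℂ × ℂ →ₗ[ℂ] ℂ × ℂ).restrictScalars ℝ).det := rfl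
  rw [h2, h, Algebra.norm_complex_apply, Complex.normSq_eq_norm_sq,
    ← LinearMap.det_toMatrix (Module.Basis.finTwoProd ℂ), Matrix.det_fin_two]
  simp only [LinearMap.toMatrix_apply, Module.Basis.finTwoProd_zero, Module.Basis.finTwoProd_one,
    Module.Basis.coe_finTwoProd_repr]
  simp
  congr 2
  ring

/-! ### The two affine sheets -/

noncomputable section

namespace FermatK3

theorem continuous_toSurface : Continuous toSurface := continuous_quotient_mk'

theorem toSurface_eq_of_scale {p q : cone} {t : ℂ} (ht : t ≠ 0) (h : (q : V) = scale t p) :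
    toSurface p = toSurface q := Quotient.sound ⟨t, ht, h⟩

/-- One of the two sheets `(x, y) ↦ (x, y, 1, ± √(x⁶ + y⁶ + 1))` of the double plane. -/
def sheetLift (ε : ℂ) (a : ℂ × ℂ) : V :=
  ![a.1, a.2, 1, ε * (a.1 ^ 6 + a.2 ^ 6 + 1) ^ ((2 : ℕ) : ℂ)⁻¹]

theorem sheetLift_mem_cone {ε : ℂ} (hε : ε ^ 2 = 1) (a : ℂ × ℂ) : sheetLift ε a ∈ cone := by
  refine ⟨Or.inr (Or.inr (by simp [sheetLift])), ?_⟩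
  have := Complex.cpow_nat_inv_pow (a.1 ^ 6 + a.2 ^ 6 + 1) (two_ne_zero)
  simp only [sheetLift, Matrix.cons_val]
  rw [mul_pow, hε, this]
  ring

/-- The map to the surface given by a sheet. -/
def sheetMap {ε : ℂ} (hε : ε ^ 2 = 1) (a : ℂ × ℂ) : Surface :=
  toSurface ⟨sheetLift ε a, sheetLift_mem_cone hε a⟩

/-- The principal root jumps across its branch cut, but it is Borel on the whole plane. -/
theorem measurable_sheetMap {ε : ℂ} (hε : ε ^ 2 = 1) : Measurable (sheetMap hε) := by
  refine continuous_toSurface.measurable.comp (Measurable.subtype_mk ?_)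
  refine measurable_pi_iff.2 fun i => ?_
  fin_cases i <;> simp [sheetLift] <;> fun_prop

/-- The density of `θ ∧ θ̄` in the affine coordinates `x, y`. -/
def affineDensity (a : ℂ × ℂ) : ENNReal := ENNReal.ofReal (4 * ‖a.1 ^ 6 + a.2 ^ 6 + 1‖⁻¹)

theorem lintegral_affineDensity :
    ∫⁻ a, affineDensity a = 4 * ∫⁻ p : ℂ × ℂ, ENNReal.ofReal (‖p.1 ^ 6 + p.2 ^ 6 + 1‖⁻¹) := by
  rw [← lintegral_const_mul _ (by fun_prop)]
  refine lintegral_congr fun a => ?_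
  rw [affineDensity, ENNReal.ofReal_mul (by norm_num)]
  simp

/-- The measure `θ ∧ θ̄` on one sheet. -/
def sheetMeasure {ε : ℂ} (hε : ε ^ 2 = 1) : Measure Surface :=
  (volume.withDensity affineDensity).map (sheetMap hε)

theorem sheetMeasure_univ {ε : ℂ} (hε : ε ^ 2 = 1) :
    sheetMeasure hε univ = ∫⁻ a, affineDensity a := by
  rw [sheetMeasure, Measure.map_apply (measurable_sheetMap hε) MeasurableSet.univ, preimage_univ,
    withDensity_apply _ MeasurableSet.univ, Measure.restrict_univ]

/-! ### Charts in affine coordinates -/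

namespace Chart

variable (c : Chart)

theorem continuousOn_lift : ContinuousOn c.lift c.U := c.holomorphic.continuousOn

theorem continuous_map : Continuous c.map :=
  continuous_toSurface.comp
    ((continuousOn_iff_continuous_domRestrict.1 c.continuousOn_lift).subtype_mk _)

theorem measurableSet_inter_preimage_lift {B : Set V} (hB : MeasurableSet B) :
    MeasurableSet (c.U ∩ c.lift ⁻¹' B) := by
  have : Measurable (c.U.domRestrict c.lift) :=
    (continuousOn_iff_continuous_domRestrict.1 c.continuousOn_lift).measurable
  have := MeasurableSet.subtype_image c.isOpen.measurableSet (this hB)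
  convert this using 1
  ext a
  simp [Set.domRestrict, and_comm]

theorem measurableSet_image_preimage {E : Set Surface} (hE : MeasurableSet E) :
    MeasurableSet (Subtype.val '' (c.map ⁻¹' E) : Set (ℂ × ℂ)) :=
  MeasurableSet.subtype_image c.isOpen.measurableSet (c.continuous_map.measurable hE)

theorem measure_apply {E : Set Surface} (hE : MeasurableSet E) :
    c.measure E = ∫⁻ a in Subtype.val '' (c.map ⁻¹' E), ENNReal.ofReal (c.density a) := by
  rw [Chart.measure, Measure.map_apply c.continuous_map.measurable hE,
    withDensity_apply _ (c.continuous_map.measurable hE),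
    setLIntegral_subtype c.isOpen.measurableSet _ fun a => ENNReal.ofReal (c.density a)]

theorem hasFDerivAt_lift_apply {a : ℂ × ℂ} (ha : a ∈ c.U) (i : Fin 4) :
    HasFDerivAt (fun b => c.lift b i)
      ((ContinuousLinearMap.proj i : V →L[ℂ] ℂ).comp (fderiv ℂ c.lift a)) a :=
  (ContinuousLinearMap.proj i : V →L[ℂ] ℂ).hasFDerivAt.comp a
    (c.holomorphic.differentiableAt (c.isOpen.mem_nhds ha)).hasFDerivAt

theorem dF_fderiv_lift {a : ℂ × ℂ} (ha : a ∈ c.U) (u : ℂ × ℂ) :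
    dF (c.lift a) (fderiv ℂ c.lift a u) = 0 := by
  have h := fun i => c.hasFDerivAt_lift_apply ha i
  have h1 := (h 3).pow 2
  have h2 := (((h 0).pow 6).add ((h 1).pow 6)).add ((h 2).pow 6)
  have h3 := h1.congr_of_eventuallyEq (f₁ := fun b => c.lift b 0 ^ 6 + c.lift b 1 ^ 6 +
      c.lift b 2 ^ 6) (by
    filter_upwards [c.isOpen.mem_nhds ha] with b hb
    exact (c.mem_cone b hb).2.symm)
  have h4 := congrArg (fun L : ℂ × ℂ →L[ℂ] ℂ => L u) (h3.unique h2)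
  simp at h4
  simp [dF, Fin.sum_univ_four, gradF]
  linear_combination h4

/-- At a zero of the coordinate where its differential also vanished, the Euler vector and the two
partial derivatives of the lift would be three independent vectors in the kernel of the coordinate
and `dF`. These are independent functionals on `ℂ⁴` by `hg`, so the kernel is a plane. -/
theorem volume_coord_eq_zero {i : Fin 4}
    (he : ∀ p : V, p i = 0 → euler p i = 0)
    (hg : ∀ p ∈ cone, p i = 0 → ∃ j, j ≠ i ∧ gradF p j ≠ 0) :
    volume {a ∈ c.U | c.lift a i = 0} = 0 := by
  refine volume_zeros_eq_zero_of_fderiv_ne_zero c.isOpen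
    (fun a ha => (c.hasFDerivAt_lift_apply ha i).differentiableAt.differentiableWithinAt)
    fun a ha h0 => ?_
  rw [(c.hasFDerivAt_lift_apply ha i).fderiv]
  by_contra! hcon
  obtain ⟨j, hji, hj⟩ := hg _ (c.mem_cone a ha) h0
  let dFL : V →ₗ[ℂ] ℂ := ∑ k, gradF (c.lift a) k • LinearMap.proj k
  have hdFL : ∀ v, dFL v = dF (c.lift a) v := fun v => by simp [dFL, dF]
  let L : V →ₗ[ℂ] ℂ × ℂ := (LinearMap.proj i).prod dFL
  have hL : ∀ v, L v = (v i, dF (c.lift a) v) := fun v => by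
    rw [← hdFL]
    rfl
  have hsurj : Function.Surjective L := by
    rintro ⟨s, t⟩
    refine ⟨Pi.single i s + Pi.single j ((t - gradF (c.lift a) i * s) / gradF (c.lift a) j), ?_⟩
    rw [hL]
    ext
    · simp [hji.symm]
    · simp only [dF, Pi.add_apply, mul_add, Finset.sum_add_distrib]
      simp [Pi.single_apply]
      field_simp
      ring
  have hker : Module.finrank ℂ (LinearMap.ker L) = 2 := by
    have h1 := LinearMap.finrank_range_add_finrank_ker L
    rw [LinearMap.range_eq_top.2 hsurj] at h1
    simp at h1
    omega
  have hdE : dF (c.lift a) (euler (c.lift a)) = 0 := by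
    have := (c.mem_cone a ha).2
    simp [dF, Fin.sum_univ_four, gradF, euler]
    linear_combination 6 * this
  have hmem : ∀ k, (![euler (c.lift a), fderiv ℂ c.lift a (1, 0), fderiv ℂ c.lift a (0, 1)]
      : Fin 3 → V) k ∈ LinearMap.ker L := by
    intro k
    rw [LinearMap.mem_ker, hL]
    fin_cases k
    · exact Prod.ext (he _ h0) hdE
    · exact Prod.ext hcon.1 (c.dF_fderiv_lift ha _)
    · exact Prod.ext hcon.2 (c.dF_fderiv_lift ha _)
  have hli : LinearIndependent ℂ fun k => (⟨_, hmem k⟩ : LinearMap.ker L) :=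
    LinearIndependent.of_comp (LinearMap.ker L).subtype (c.immersion a ha)
  have := hli.fintype_card_le_finrank
  rw [hker] at this
  simp at this

theorem volume_z_eq_zero : volume {a ∈ c.U | c.lift a 2 = 0} = 0 := by
  refine c.volume_coord_eq_zero (fun p hp => by simp [euler, hp]) fun p hp h2 => ?_
  rcases hp.1 with h | h | h
  · exact ⟨0, by decide, by simp [gradF, h]⟩
  · exact ⟨1, by decide, by simp [gradF, h]⟩
  · exact absurd h2 h

theorem volume_w_eq_zero : volume {a ∈ c.U | c.lift a 3 = 0} = 0 := by
  refine c.volume_coord_eq_zero (fun p hp => by simp [euler, hp]) fun p hp h2 => ?_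
  rcases hp.1 with h | h | h
  · exact ⟨0, by decide, by simp [gradF, h]⟩
  · exact ⟨1, by decide, by simp [gradF, h]⟩
  · exact ⟨2, by decide, by simp [gradF, h]⟩

/-- The affine coordinates `(x / z, y / z)` in the chart. -/
def affine (a : ℂ × ℂ) : ℂ × ℂ := (c.lift a 0 / c.lift a 2, c.lift a 1 / c.lift a 2)

theorem hasFDerivAt_div_lift {a : ℂ × ℂ} (ha : a ∈ c.U) (hz : c.lift a 2 ≠ 0) (i : Fin 4) :
    HasFDerivAt (fun b => c.lift b i / c.lift b 2) (c.lift a i •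
      (-(c.lift a 2 ^ 2)⁻¹ • (ContinuousLinearMap.proj 2 : V →L[ℂ] ℂ).comp (fderiv ℂ c.lift a)) +
      (c.lift a 2)⁻¹ • (ContinuousLinearMap.proj i : V →L[ℂ] ℂ).comp (fderiv ℂ c.lift a)) a := by
  have h := fun i => c.hasFDerivAt_lift_apply ha i
  have h2 := (hasDerivAt_inv hz).comp_hasFDerivAt a (h 2)
  simp only [div_eq_mul_inv]
  exact (h i).mul h2

theorem differentiableAt_affine {a : ℂ × ℂ} (ha : a ∈ c.U) (hz : c.lift a 2 ≠ 0) :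
    DifferentiableAt ℂ c.affine a :=
  ((c.hasFDerivAt_div_lift ha hz 0).prodMk (c.hasFDerivAt_div_lift ha hz 1)).differentiableAt

theorem fderiv_affine {a : ℂ × ℂ} (ha : a ∈ c.U) (hz : c.lift a 2 ≠ 0) (u : ℂ × ℂ) :
    fderiv ℂ c.affine a u =
      ((fderiv ℂ c.lift a u 0 * c.lift a 2 - c.lift a 0 * fderiv ℂ c.lift a u 2) / c.lift a 2 ^ 2,
       (fderiv ℂ c.lift a u 1 * c.lift a 2 - c.lift a 1 * fderiv ℂ c.lift a u 2) /
        c.lift a 2 ^ 2) := by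
  have h := (c.hasFDerivAt_div_lift ha hz 0).prodMk (c.hasFDerivAt_div_lift ha hz 1)
  rw [show fderiv ℂ c.affine a = _ from h.fderiv]
  ext <;> simp <;> field_simp <;> ring

theorem affine_sextic {a : ℂ × ℂ} (ha : a ∈ c.U) (hz : c.lift a 2 ≠ 0) :
    (c.affine a).1 ^ 6 + (c.affine a).2 ^ 6 + 1 = (c.lift a 3 / c.lift a 2 ^ 3) ^ 2 := by
  rw [div_pow (c.lift a 3), (c.mem_cone a ha).2]
  simp only [affine]
  field_simp

/-- In affine coordinates the density of `θ ∧ θ̄` is `4 / |x⁶ + y⁶ + 1|`. -/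
theorem density_eq {a : ℂ × ℂ} (ha : a ∈ c.U) (hz : c.lift a 2 ≠ 0) (hw : c.lift a 3 ≠ 0) :
    ENNReal.ofReal (c.density a) =
      ENNReal.ofReal |((fderiv ℂ c.affine a).restrictScalars ℝ).det| *
        affineDensity (c.affine a) := by
  let A := fderiv ℂ c.affine a
  let d := (A (1, 0)).1 * (A (0, 1)).2 - (A (1, 0)).2 * (A (0, 1)).1
  let k := c.lift a 2 ^ 3 / c.lift a 3 * d
  have hA : ∀ u : ℂ × ℂ, A u = u.1 • A (1, 0) + u.2 • A (0, 1) := by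
    intro u
    rw [← map_smul, ← map_smul, ← map_add]
    congr 1
    ext <;> simp
  -- In homogeneous coordinates `θ = (z³ / w) d(x/z) ∧ d(y/z)`, so the pullback acquires the complex
  -- Jacobian `d`.
  have hpull : ∀ u v, c.pullback a u v = k * (u.1 * v.2 - u.2 * v.1) := by
    intro u v
    have h1 : c.pullback a u v = c.lift a 2 ^ 3 / c.lift a 3 *
        ((A u).1 * (A v).2 - (A u).2 * (A v).1) := by
      rw [Chart.pullback, theta_eq (c.mem_cone a ha) hw (c.dF_fderiv_lift ha u)
        (c.dF_fderiv_lift ha v)]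
      simp only [A, c.fderiv_affine ha hz]
      field_simp
      ring
    rw [h1, hA u, hA v]
    simp only [Prod.fst_add, Prod.snd_add, Prod.smul_fst, Prod.smul_snd, smul_eq_mul, k, d]
    ring
  -- Four of the six terms of the wedge survive on the real frame, each equal to `|k|²`.
  have hden : c.density a = 4 * ‖k‖ ^ 2 := by
    rw [Chart.density]
    simp only [hpull, wedge, realFrame]
    rw [← Complex.normSq_eq_norm_sq, Complex.normSq_apply]
    simp
    ring
  rw [det_restrictScalars_complex_prod, affineDensity, c.affine_sextic ha hz,
    abs_of_nonneg (by positivity),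
    ← ENNReal.ofReal_mul (by positivity), hden]
  congr 1
  change 4 * ‖c.lift a 2 ^ 3 / c.lift a 3 * d‖ ^ 2 = ‖d‖ ^ 2 * _
  simp only [norm_mul, norm_div, norm_pow]
  field_simp

end Chart

/-- The part of the cone with `z, w ≠ 0` that lies over a sheet. -/
def sheetSet (ε : ℂ) : Set V :=
  {p | p 2 ≠ 0 ∧ p 3 ≠ 0 ∧ p 3 / p 2 ^ 3 = ε * ((p 3 / p 2 ^ 3) ^ 2) ^ ((2 : ℕ) : ℂ)⁻¹}

theorem measurableSet_sheetSet (ε : ℂ) : MeasurableSet (sheetSet ε) := by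
  have h2 : Measurable fun p : V => p 2 := measurable_pi_apply 2
  have h3 : Measurable fun p : V => p 3 := measurable_pi_apply 3
  exact (h2 (measurableSet_singleton 0).compl).inter
    ((h3 (measurableSet_singleton 0).compl).inter
      (measurableSet_eq_fun (by fun_prop) (by fun_prop)))

theorem mem_sheetSet_or {p : V} (hz : p 2 ≠ 0) (hw : p 3 ≠ 0) :
    p ∈ sheetSet 1 ∨ p ∈ sheetSet (-1) := by
  have h := Complex.cpow_nat_inv_pow ((p 3 / p 2 ^ 3) ^ 2) two_ne_zero
  rcases sq_eq_sq_iff_eq_or_eq_neg.1 h with h | h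
  · exact Or.inl ⟨hz, hw, by rw [h, one_mul]⟩
  · exact Or.inr ⟨hz, hw, by rw [h]; ring⟩

/-! ### Comparison of a chart with the sheets -/

namespace Chart

variable (c : Chart)

theorem sheetMap_affine {ε : ℂ} (hε : ε ^ 2 = 1) {a : ℂ × ℂ} (ha : a ∈ c.U)
    (hs : c.lift a ∈ sheetSet ε) : sheetMap hε (c.affine a) = c.map ⟨a, ha⟩ := by
  obtain ⟨hz, hw, h⟩ := hs
  -- The scaling factor is `z` itself.
  refine toSurface_eq_of_scale hz ?_
  have h3 : ε * (((c.affine a).1 ^ 6 + (c.affine a).2 ^ 6 + 1) ^ ((2 : ℕ) : ℂ)⁻¹) =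
      c.lift a 3 / c.lift a 2 ^ 3 := by
    rw [c.affine_sextic ha hz, ← h]
  ext i
  fin_cases i
  · simp [scale, sheetLift, affine]
    field_simp
  · simp [scale, sheetLift, affine]
    field_simp
  · simp [scale, sheetLift]
  · change c.lift a 3 = c.lift a 2 ^ 3 * (ε * _)
    rw [h3]
    field_simp

/-- Over one sheet the affine coordinates determine the point of the surface, so they are injective
because the chart is. Change of variables then gives an integral over part of the preimage of `E`.
-/
theorem setLIntegral_density_le {ε : ℂ} (hε : ε ^ 2 = 1) {E : Set Surface} (hE : MeasurableSet E) :
    ∫⁻ a in Subtype.val '' (c.map ⁻¹' E) ∩ (c.U ∩ c.lift ⁻¹' sheetSet ε),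
      ENNReal.ofReal (c.density a) ≤ sheetMeasure hε E := by
  set G := Subtype.val '' (c.map ⁻¹' E) ∩ (c.U ∩ c.lift ⁻¹' sheetSet ε) with hG
  have hGm : MeasurableSet G := (c.measurableSet_image_preimage hE).inter
    (c.measurableSet_inter_preimage_lift (measurableSet_sheetSet ε))
  have hinj : InjOn c.affine G := by
    intro a ha b hb hab
    have h := c.sheetMap_affine hε ha.2.1 ha.2.2
    rw [hab, c.sheetMap_affine hε hb.2.1 hb.2.2] at h
    exact (congrArg Subtype.val (c.injective h)).symm
  have hder : ∀ a ∈ G, HasFDerivWithinAt c.affine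
      ((fderiv ℂ c.affine a).restrictScalars ℝ) G a := fun a ha =>
    ((c.differentiableAt_affine ha.2.1 ha.2.2.1).hasFDerivAt.restrictScalars ℝ).hasFDerivWithinAt
  have : (volume : Measure (ℂ × ℂ)).IsAddHaarMeasure :=
    inferInstanceAs ((volume : Measure ℂ).prod (volume : Measure ℂ)).IsAddHaarMeasure
  have hpre : MeasurableSet (sheetMap hε ⁻¹' E) := measurable_sheetMap hε hE
  calc _ = ∫⁻ a in G, ENNReal.ofReal |((fderiv ℂ c.affine a).restrictScalars ℝ).det| *
        affineDensity (c.affine a) :=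
        setLIntegral_congr_fun hGm fun a ha => c.density_eq ha.2.1 ha.2.2.1 ha.2.2.2.1
    _ = ∫⁻ b in c.affine '' G, affineDensity b :=
        (lintegral_image_eq_lintegral_abs_det_fderiv_mul volume hGm hder hinj _).symm
    _ ≤ ∫⁻ b in sheetMap hε ⁻¹' E, affineDensity b := by
        refine lintegral_mono_set ?_
        rintro _ ⟨a, ha, rfl⟩
        rw [mem_preimage, c.sheetMap_affine hε ha.2.1 ha.2.2]
        obtain ⟨b, hb, hba⟩ := ha.1
        subst hba
        exact hb
    _ = _ := by
        rw [sheetMeasure, Measure.map_apply (measurable_sheetMap hε) hE, withDensity_apply _ hpre]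

theorem measure_le : c.measure ≤ sheetMeasure (one_pow 2) + sheetMeasure neg_one_sq := by
  refine Measure.le_iff.2 fun E hE => ?_
  rw [c.measure_apply hE, Measure.add_apply]
  have hcover : Subtype.val '' (c.map ⁻¹' E) ⊆
      ({a ∈ c.U | c.lift a 2 = 0} ∪ {a ∈ c.U | c.lift a 3 = 0}) ∪
      (Subtype.val '' (c.map ⁻¹' E) ∩ (c.U ∩ c.lift ⁻¹' sheetSet 1) ∪
        Subtype.val '' (c.map ⁻¹' E) ∩ (c.U ∩ c.lift ⁻¹' sheetSet (-1))) := by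
    rintro a ha
    have haU : a ∈ c.U := by
      obtain ⟨b, -, rfl⟩ := ha
      exact b.2
    by_cases hz : c.lift a 2 = 0
    · exact Or.inl (Or.inl ⟨haU, hz⟩)
    by_cases hw : c.lift a 3 = 0
    · exact Or.inl (Or.inr ⟨haU, hw⟩)
    exact Or.inr ((mem_sheetSet_or hz hw).imp (fun h => ⟨ha, haU, h⟩) fun h => ⟨ha, haU, h⟩)
  refine (lintegral_mono_set hcover).trans ((lintegral_union_le _ _ _).trans ?_)
  rw [setLIntegral_measure_zero _ _ (measure_union_null c.volume_z_eq_zero c.volume_w_eq_zero),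
    zero_add]
  exact (lintegral_union_le _ _ _).trans
    (add_le_add (c.setLIntegral_density_le _ hE) (c.setLIntegral_density_le _ hE))

end Chart

/-! ### The sheet charts and the total mass -/

theorem sheetLift_differentiableOn (ε : ℂ) :
    DifferentiableOn ℂ (sheetLift ε) {p | p.1 ^ 6 + p.2 ^ 6 + 1 ∈ Complex.slitPlane} := by
  intro p hp
  refine DifferentiableAt.differentiableWithinAt (differentiableAt_pi.2 fun i => ?_)
  fin_cases i
  · exact differentiableAt_fst
  · exact differentiableAt_snd
  · exact differentiableAt_const 1
  · have hq : DifferentiableAt ℂ (fun q : ℂ × ℂ => q.1 ^ 6 + q.2 ^ 6 + 1) p := by fun_prop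
    exact (hq.cpow (differentiableAt_const _) hp).const_mul ε

theorem fderiv_sheetLift_apply {ε : ℂ} {p : ℂ × ℂ}
    (hp : p.1 ^ 6 + p.2 ^ 6 + 1 ∈ Complex.slitPlane) (u : ℂ × ℂ) :
    fderiv ℂ (sheetLift ε) p u 0 = u.1 ∧ fderiv ℂ (sheetLift ε) p u 1 = u.2 ∧
      fderiv ℂ (sheetLift ε) p u 2 = 0 := by
  have ho : IsOpen {p : ℂ × ℂ | p.1 ^ 6 + p.2 ^ 6 + 1 ∈ Complex.slitPlane} :=
    Complex.isOpen_slitPlane.preimage (by fun_prop)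
  have hd := (sheetLift_differentiableOn ε).differentiableAt (ho.mem_nhds hp)
  have h : ∀ i, fderiv ℂ (sheetLift ε) p u i = fderiv ℂ (fun q => sheetLift ε q i) p u := fun i =>
    congrArg (fun L : ℂ × ℂ →L[ℂ] ℂ => L u)
      ((ContinuousLinearMap.proj i : V →L[ℂ] ℂ).hasFDerivAt.comp p hd.hasFDerivAt).fderiv.symm
  simp only [h]
  refine ⟨?_, ?_, ?_⟩
  · change fderiv ℂ Prod.fst p u = u.1
    simp [fderiv_fst]
  · change fderiv ℂ Prod.snd p u = u.2
    simp [fderiv_snd]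
  · change fderiv ℂ (fun _ => (1 : ℂ)) p u = 0
    simp

/-- The chart given by a sheet outside the branch cut. -/
def sheetChart {ε : ℂ} (hε : ε ^ 2 = 1) : Chart where
  U := {p | p.1 ^ 6 + p.2 ^ 6 + 1 ∈ Complex.slitPlane}
  isOpen := Complex.isOpen_slitPlane.preimage (by fun_prop)
  lift := sheetLift ε
  mem_cone a _ := sheetLift_mem_cone hε a
  holomorphic := sheetLift_differentiableOn ε
  injective := by
    rintro ⟨a, ha⟩ ⟨b, hb⟩ hab
    obtain ⟨t, -, h⟩ := Quotient.exact hab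
    have h0 := congrFun h 0
    have h1 := congrFun h 1
    have h2 := congrFun h 2
    simp [scale, sheetLift] at h0 h1 h2
    subst h2
    exact Subtype.ext (Prod.ext (by simpa using h0.symm) (by simpa using h1.symm))
  immersion := by
    intro a ha
    obtain ⟨x0, x1, x2⟩ := fderiv_sheetLift_apply (ε := ε) ha (1, 0)
    obtain ⟨y0, y1, y2⟩ := fderiv_sheetLift_apply (ε := ε) ha (0, 1)
    rw [Fintype.linearIndependent_iff]
    intro g hg
    have h0 := congrFun hg 0
    have h1 := congrFun hg 1
    have h2 := congrFun hg 2
    simp [Fin.sum_univ_succ, x0, x1, x2, y0, y1, y2, euler, sheetLift] at h0 h1 h2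
    rw [h2] at h0 h1
    intro i
    fin_cases i
    · exact h2
    · simpa using h0
    · simpa using h1

theorem sheetChart_affine {ε : ℂ} (hε : ε ^ 2 = 1) : (sheetChart hε).affine = id := by
  ext a <;> simp [Chart.affine, sheetChart, sheetLift]

/-- The domain is conull and the affine map is the identity, so any `E` containing the image
receives the full mass of a sheet. -/
theorem sheetChart_measure_eq {ε : ℂ} (hε : ε ^ 2 = 1) {E : Set Surface} (hE : MeasurableSet E)
    (h : ∀ a, (sheetChart hε).map a ∈ E) :
    (sheetChart hε).measure E = ∫⁻ a, affineDensity a := by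
  have him : Subtype.val '' ((sheetChart hε).map ⁻¹' E) = (sheetChart hε).U := by
    rw [show (sheetChart hε).map ⁻¹' E = univ from eq_univ_of_forall h, image_univ,
      Subtype.range_coe]
  rw [(sheetChart hε).measure_apply hE, him,
    setLIntegral_congr_fun (g := affineDensity) (sheetChart hε).isOpen.measurableSet]
  · have : (sheetChart hε).U =ᵐ[volume] univ := by
      rw [ae_eq_univ]
      exact volume_fermat_sextic_notMem_slitPlane
    rw [setLIntegral_congr this, Measure.restrict_univ]
  · intro a ha
    have hz : (sheetChart hε).lift a 2 ≠ 0 := by simp [sheetChart, sheetLift]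
    have hw : (sheetChart hε).lift a 3 ≠ 0 := by
      intro h0
      have h1 := ((sheetChart hε).mem_cone a ha).2
      rw [h0] at h1
      refine Complex.slitPlane_ne_zero ha ?_
      simpa [sheetChart, sheetLift] using h1.symm
    dsimp only
    rw [(sheetChart hε).density_eq ha hz hw, sheetChart_affine, det_restrictScalars_complex_prod]
    simp

/-- The half `Re (w / z³) > 0` of the affine piece `z ≠ 0` of the surface. -/
def positiveHalf : Set Surface :=
  {s | Quotient.lift (fun p : cone => 0 < ((p : V) 3 * (starRingEnd ℂ) ((p : V) 2) ^ 3).re) (by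
    rintro p q ⟨t, ht, h⟩
    -- `w z̄³ = |z|⁶ (w / z³)` where `z ≠ 0`; scaling by `t` multiplies it by `|t|⁶ > 0`, so the
    -- sign of its real part is well defined.
    have e : (q : V) 3 * (starRingEnd ℂ) ((q : V) 2) ^ 3 =
        ((Complex.normSq t ^ 3 : ℝ) : ℂ) * ((p : V) 3 * (starRingEnd ℂ) ((p : V) 2) ^ 3) := by
      rw [h]
      push_cast
      rw [← Complex.mul_conj]
      simp [scale]
      ring
    have hpos : 0 < Complex.normSq t ^ 3 := pow_pos (Complex.normSq_pos.2 ht) 3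
    rw [e, Complex.re_ofReal_mul, mul_pos_iff_of_pos_left hpos]) s}

theorem isOpen_positiveHalf : IsOpen positiveHalf := by
  refine isOpen_coinduced.2 ?_
  change IsOpen {p : cone | 0 < ((p : V) 3 * (starRingEnd ℂ) ((p : V) 2) ^ 3).re}
  refine isOpen_lt continuous_const ?_
  have h : ∀ i, Continuous fun p : cone => (p : V) i := fun i =>
    (continuous_apply i).comp continuous_subtype_val
  exact Complex.continuous_re.comp ((h 3).mul ((Complex.continuous_conj.comp (h 2)).pow 3))

theorem sqrt_re_pos {c : ℂ} (hc : c ∈ Complex.slitPlane) : 0 < (c ^ ((2 : ℕ) : ℂ)⁻¹).re := by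
  rw [Nat.cast_ofNat, Complex.cpow_inv_two_re]
  refine sqrt_pos.2 (half_pos ?_)
  rcases Complex.mem_slitPlane_iff.1 hc with h | h
  · positivity
  · have := (abs_lt.1 (Complex.abs_re_lt_norm.2 h)).1
    linarith

theorem nu_univ : nu univ = 8 * ∫⁻ p : ℂ × ℂ, ENNReal.ofReal (‖p.1 ^ 6 + p.2 ^ 6 + 1‖⁻¹) := by
  have e : 8 * ∫⁻ p : ℂ × ℂ, ENNReal.ofReal (‖p.1 ^ 6 + p.2 ^ 6 + 1‖⁻¹) =
      (∫⁻ a, affineDensity a) + ∫⁻ a, affineDensity a := by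
    rw [lintegral_affineDensity, ← add_mul]
    norm_num
  rw [e]
  refine le_antisymm ?_ ?_
  · have h : nu ≤ _ := iSup_le fun c => c.measure_le
    refine (h univ).trans ?_
    rw [Measure.add_apply, sheetMeasure_univ, sheetMeasure_univ]
  · have hm := isOpen_positiveHalf.measurableSet
    have hnu : ∀ c : Chart, c.measure ≤ nu := fun c => le_iSup Chart.measure c
    -- A supremum of measures dominates each term but not their sum; the two sheet charts contribute
    -- additively because the principal root has positive real part, which puts their images on
    -- opposite sides of this splitting.
    rw [← measure_add_measure_compl hm]
    refine add_le_add ?_ ?_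
    · rw [← sheetChart_measure_eq (one_pow 2) hm fun a => ?_]
      · exact hnu _ _
      · change 0 < (_ * _ : ℂ).re
        simpa [sheetChart, sheetLift] using sqrt_re_pos a.2
    · rw [← sheetChart_measure_eq neg_one_sq hm.compl fun a => ?_]
      · exact hnu _ _
      · change ¬ 0 < (_ * _ : ℂ).re
        simpa [sheetChart, sheetLift] using (sqrt_re_pos a.2).le

end FermatK3

end

theorem mainTheorem3 :
    IntervalIntegrable (fun p : ℝ => (1 - p ^ 3) ^ (-(2 / 3) : ℝ)) MeasureTheory.volume 0 1 ∧
      FermatK3.nu Set.univ = ENNReal.ofReal (27 * FermatK3.LI ^ 4) :=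
  ⟨intervalIntegrable_one_sub_cube_rpow,
    FermatK3.nu_univ.trans eight_mul_lintegral_inv_norm_fermat_sextic⟩
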